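/- Let $m>0$, and let $L^2(\mu_m)$ be the space of square integrable functions on $\mathbb C$ with respect to $d\mu_m(z)=\frac1\pi e^{-m|z|^2}\,dA(z)$, where $A$ is Lebesgue area measure. Let $\mathcal F_m$ be the Fock space of all entire functions in $L^2(\mu_m)$, and for $n\ge 0$ let $e_n(z)=\sqrt{m^{n+1}/n!}\;z^n$ (the standard orthonormal basis of $\mathcal F_m$). For an integer $N\ge 0$ let $F^{N,m}$ be the closure in $L^2(\mu_m)$ of the linear span of the functions $\bar z^j z^k$ with $0\le j\le N-1$ and $k\ge 0$ (so $F^{0,m}=\{0\}$), and let $P_{F^{N,m}}$ be the orthogonal projection of $L^2(\mu_m)$ onto $F^{N,m}$. For an integer $s\ge 0$ and an analytic polynomial $f$ put $$\tilde H^N_{\bar z^s} f=(I-P_{F^{N,m}})(\bar z^s f).$$ Then: 1. $\tilde H^N_{\bar z^s}$ extends to a bounded operator from $\mathcal F_m$ to $L^2(\mu_m)$ if and only if $s\le N$. 2. $\tilde H^N_{\bar z^s}$ extends to a compact operator from $\mathcal F_m$ to $L^2(\mu_m)$ if and only if $\tilde H^N_{\bar z^s}=0$, and this happens if and only if $s<N$.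 Moreover, any bounded operator $T:\mathcal F_m\to L^2(\mu_m)$ that extends $\tilde H^N_{\bar z^s}$ is compact if and only if $T=0$. 3. For all integers $p,n\ge 0$ with $p\ne n$ one has $\langle \tilde H^N_{\bar z^s}e_p,\tilde H^N_{\bar z^s}e_n\rangle=0$, and for all $n\ge 0$ $$\|\tilde H^N_{\bar z^s}e_n\|^2=\frac{s!}{m^s}\sum_{r=N}^{s}\binom{n}{s-r}\binom{s}{r},$$ where the sum is empty (equal to $0$) if $s<N$. -/

import Mathlib

open MeasureTheory Polynomial ComplexConjugate
open scoped Nat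

noncomputable section

namespace FockHankel

/-- The measure `dμ_m(z) = π⁻¹ exp (-m |z|²) dA(z)` on `ℂ`, with `A` the Lebesgue area measure. -/
def gaussMeasure (m : ℝ) : Measure ℂ :=
  volume.withDensity fun z => ENNReal.ofReal (Real.pi⁻¹ * Real.exp (-m * ‖z‖ ^ 2))

/-- The Hilbert space `L²(μ_m)` of complex-valued functions. -/
abbrev L2 (m : ℝ) := Lp ℂ 2 (gaussMeasure m)

/-- The classical Fock space: the (classes of) entire functions in `L²(μ_m)`. -/
def fockSpace (m : ℝ) : Submodule ℂ (L2 m) where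
  carrier := {u | ∃ f : ℂ → ℂ, Differentiable ℂ f ∧ u =ᵐ[gaussMeasure m] f}
  zero_mem' := ⟨0, differentiable_const 0, Lp.coeFn_zero ℂ 2 (gaussMeasure m)⟩
  add_mem' := by
    rintro u v ⟨f, hf, huf⟩ ⟨g, hg, hvg⟩
    exact ⟨f + g, hf.add hg, (Lp.coeFn_add u v).trans (huf.add hvg)⟩
  smul_mem' := by
    rintro c u ⟨f, hf, huf⟩
    exact ⟨c • f, hf.const_smul c, (Lp.coeFn_smul c u).trans (huf.const_smul c)⟩

/-- The polyanalytic Fock space of order `N`: the closure in `L²(μ_m)` of the linear span of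
the functions `z̄ ^ j * z ^ k` with `0 ≤ j ≤ N - 1` and `k ∈ ℕ`. -/
def polyFockSpace (m : ℝ) (N : ℕ) : Submodule ℂ (L2 m) :=
  (Submodule.span ℂ {u : L2 m | ∃ j k : ℕ, j < N ∧
    u =ᵐ[gaussMeasure m] fun z => conj z ^ j * z ^ k}).topologicalClosure

instance (m : ℝ) (N : ℕ) : CompleteSpace (polyFockSpace m N) :=
  Submodule.topologicalClosure.completeSpace _

lemma memLp_monomial {m : ℝ} (hm : 0 < m) (s n : ℕ) :
    MemLp (fun z : ℂ => conj z ^ s * z ^ n) 2 (gaussMeasure m) := by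
  have hc : Continuous (fun z : ℂ => conj z ^ s * z ^ n) := by fun_prop
  rw [memLp_two_iff_integrable_sq_norm hc.aestronglyMeasurable]
  unfold gaussMeasure
  rw [integrable_withDensity_iff (by fun_prop) (by simp)]
  have h := Complex.integral_rpow_mul_exp_neg_mul_rpow (p := 2) (q := ((2 * (s + n) : ℕ) : ℝ))
    (b := m) (by norm_num) (by
      have : (0 : ℝ) ≤ ((2 * (s + n) : ℕ) : ℝ) := Nat.cast_nonneg _
      linarith) hm
  have hi : Integrable (fun z : ℂ => ‖z‖ ^ ((2 * (s + n) : ℕ) : ℝ) *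
      Real.exp (-m * ‖z‖ ^ (2 : ℝ))) := by
    refine Integrable.of_integral_ne_zero ?_
    rw [h]
    have := Real.Gamma_pos_of_pos (s := (((2 * (s + n) : ℕ) : ℝ) + 2) / 2) (by positivity)
    have := Real.pi_pos
    positivity
  refine (hi.const_mul Real.pi⁻¹).congr (Filter.Eventually.of_forall fun z => ?_)
  have h0 : 0 ≤ Real.pi⁻¹ * Real.exp (-m * ‖z‖ ^ 2) := by positivity
  simp only [ENNReal.toReal_ofReal h0, Real.rpow_natCast, Real.rpow_ofNat, norm_mul, norm_pow,
    RCLike.norm_conj]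
  ring

lemma memLp_conj_pow_mul {m : ℝ} (hm : 0 < m) (s : ℕ) (p : ℂ[X]) :
    MemLp (fun z : ℂ => conj z ^ s * p.eval z) 2 (gaussMeasure m) := by
  induction p using Polynomial.induction_on' with
  | add p q hp hq =>
    simp only [eval_add, mul_add]
    exact hp.add hq
  | monomial n a =>
    have h := (memLp_monomial hm s n).const_mul a
    refine h.congr_norm (by fun_prop) (Filter.Eventually.of_forall fun z => ?_)
    simp only [eval_monomial, norm_mul]
    ring

/-- The linear map `f ↦ z̄ ^ s * f` from analytic polynomials to `L²(μ_m)`. -/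
def conjPowMul {m : ℝ} (hm : 0 < m) (s : ℕ) : ℂ[X] →ₗ[ℂ] L2 m where
  toFun p := (memLp_conj_pow_mul hm s p).toLp
  map_add' p q := by
    rw [← MemLp.toLp_add]
    exact MemLp.toLp_congr _ _ (Filter.Eventually.of_forall fun z => by simp [mul_add])
  map_smul' c p := by
    rw [RingHom.id_apply, ← MemLp.toLp_const_smul]
    exact MemLp.toLp_congr _ _ (Filter.Eventually.of_forall fun z => by simp; ring)

/-- An analytic polynomial, viewed as an element of the Fock space. -/
def polyToFock {m : ℝ} (hm : 0 < m) : ℂ[X] →ₗ[ℂ] fockSpace m :=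
  (conjPowMul hm 0).codRestrict (fockSpace m) fun p =>
    ⟨fun z => p.eval z, p.differentiable,
      (memLp_conj_pow_mul hm 0 p).coeFn_toLp.trans
        (Filter.Eventually.of_forall fun z => by simp)⟩

/-- The operator `f ↦ (I - P) (z̄ ^ s * f)` on analytic polynomials `f`, where `P` is the
orthogonal projection of `L²(μ_m)` onto the polyanalytic Fock space of order `N`. -/
def hankel {m : ℝ} (hm : 0 < m) (N s : ℕ) : ℂ[X] →ₗ[ℂ] L2 m :=
  (LinearMap.id - ((polyFockSpace m N).starProjection : L2 m →ₗ[ℂ] L2 m)) ∘ₗ conjPowMul hm s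

/-- The bounded operator `T` from the Fock space to `L²(μ_m)` extends `hankel hm N s`. -/
def Extends {m : ℝ} (hm : 0 < m) (N s : ℕ) (T : fockSpace m →L[ℂ] L2 m) : Prop :=
  ∀ p : ℂ[X], T (polyToFock hm p) = hankel hm N s p

/-- The standard orthonormal basis `e_n(z) = (m ^ (n + 1) / n!) ^ (1/2) * z ^ n` of the
Fock space. -/
def basisPoly (m : ℝ) (n : ℕ) : ℂ[X] :=
  monomial n ((√(m ^ (n + 1) / (n ! : ℝ)) : ℝ) : ℂ)

end FockHankel

end

/-! ### Rotation invariance and moments of the Gaussian measure. -/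

noncomputable section

namespace FockHankel

variable {m : ℝ}

/-! Let `D = z̄ - m⁻¹∂`. Integration by parts against the Gaussian weight shows that `D` is formally
adjoint to `m⁻¹∂̄`. Hence `D^r z^k` is orthogonal to every `z̄^a z^b` with `a < r`, while it has
degree at most `r` in `z̄`: it lies in the polyanalytic space of order `N` if `r < N` and in its
orthogonal complement if `r ≥ N` (`herm_mem_polyFockSpace`, `herm_mem_orthogonal`).

Since `D` and `∂` commute, the binomial theorem for `z̄^s = (D + m⁻¹∂)^s` writes `z̄^s z^n` as a
combination of such functions (`herm_eq_sum`). The projection only deletes the terms with `r < N`,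
and the norm formula and orthogonality follow (`inner_hankel_monomial`).

The rest is read off the norms. They grow at least linearly in `n` if `s > N`; if `s = N` they are
constant, so the operator is a multiple of an isometry, bounded but not compact; if `s < N` the
operator is zero. That a bounded extension of zero vanishes requires density of the polynomials in
the Fock space (`fockSpace_le_polyClosure`). -/

lemma integral_gaussMeasure (m : ℝ) (f : ℂ → ℂ) :
    ∫ z, f z ∂gaussMeasure m =
      ∫ z, ((Real.pi⁻¹ * Real.exp (-m * ‖z‖ ^ 2) : ℝ) : ℂ) * f z := by
  unfold gaussMeasure
  rw [integral_withDensity_eq_integral_toReal_smul (by fun_prop) (by simp)]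
  refine integral_congr_ae (Filter.Eventually.of_forall fun z => ?_)
  have h0 : 0 ≤ Real.pi⁻¹ * Real.exp (-m * ‖z‖ ^ 2) := by positivity
  simp only [ENNReal.toReal_ofReal h0, Complex.real_smul]

/-- The Gaussian measure is invariant under rotations about the origin. -/
lemma measurePreserving_rotation (m : ℝ) (a : Circle) :
    MeasurePreserving (rotation a) (gaussMeasure m) (gaussMeasure m) := by
  have h : MeasurePreserving (rotation a) (volume : Measure ℂ) volume :=
    LinearIsometryEquiv.measurePreserving _
  refine ⟨h.measurable, ?_⟩
  ext s hs
  rw [Measure.map_apply h.measurable hs, gaussMeasure, withDensity_apply _ hs,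
    withDensity_apply _ (h.measurable hs),
    ← h.setLIntegral_comp_preimage hs (by fun_prop)]
  simp only [rotation_apply, norm_mul, Circle.norm_coe, one_mul]

lemma integral_rotation (m : ℝ) (a : Circle) (f : ℂ → ℂ) :
    ∫ z, f (a * z) ∂gaussMeasure m = ∫ z, f z ∂gaussMeasure m := by
  have := (measurePreserving_rotation m a).integral_comp
    (rotation a).toHomeomorph.measurableEmbedding f
  simpa using this

/-- The moments of the Gaussian measure. -/
lemma integral_pow_mul_conj_pow (hm : 0 < m) (p q : ℕ) :
    ∫ z, z ^ p * conj z ^ q ∂gaussMeasure m =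
      if p = q then ((p ! / m ^ (p + 1) : ℝ) : ℂ) else 0 := by
  split_ifs with hpq
  · subst hpq
    rw [integral_gaussMeasure]
    have h := Complex.integral_rpow_mul_exp_neg_mul_rpow (p := 2) (q := ((2 * p : ℕ) : ℝ))
      (b := m) (by norm_num) (by
        have : (0 : ℝ) ≤ ((2 * p : ℕ) : ℝ) := Nat.cast_nonneg _
        linarith) hm
    have e1 : -(((2 * p : ℕ) : ℝ) + 2) / 2 = -((p + 1 : ℕ) : ℝ) := by push_cast; ring
    have e2 : (((2 * p : ℕ) : ℝ) + 2) / 2 = (p : ℝ) + 1 := by push_cast; ring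
    rw [e1, e2, Real.Gamma_nat_eq_factorial, Real.rpow_neg hm.le, Real.rpow_natCast] at h
    have : ∀ z : ℂ, ((Real.pi⁻¹ * Real.exp (-m * ‖z‖ ^ 2) : ℝ) : ℂ) * (z ^ p * conj z ^ p) =
        ((Real.pi⁻¹ * (‖z‖ ^ ((2 * p : ℕ) : ℝ) * Real.exp (-m * ‖z‖ ^ (2 : ℝ))) : ℝ) : ℂ) := by
      intro z
      rw [← mul_pow, Complex.mul_conj', Real.rpow_natCast, Real.rpow_ofNat, pow_mul]
      push_cast
      ring
    simp_rw [this]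
    rw [integral_complex_ofReal, integral_const_mul, h]
    congr 1
    have := Real.pi_pos
    field_simp
  · set I := ∫ z, z ^ p * conj z ^ q ∂gaussMeasure m with hI
    have hne : ((p : ℝ) - q) ≠ 0 := sub_ne_zero.2 (by exact_mod_cast hpq)
    -- Rotation by this angle multiplies the integrand by `exp (iπ) = -1`, so the integral equals
    -- its own negative.
    set a : Circle := Circle.exp (Real.pi / ((p : ℝ) - q)) with ha
    have key : (a : ℂ) ^ p * conj (a : ℂ) ^ q = -1 := by
      have : conj (a : ℂ) = (Circle.exp (-(Real.pi / ((p : ℝ) - q))) : Circle) := by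
        rw [Circle.exp_neg, ← Circle.coe_inv_eq_conj]
      rw [this, ha, Circle.coe_exp, Circle.coe_exp, ← Complex.exp_nat_mul, ← Complex.exp_nat_mul,
        ← Complex.exp_add, ← Complex.exp_pi_mul_I]
      congr 1
      have hne' : ((p : ℂ) - q) ≠ 0 := by exact_mod_cast hne
      push_cast
      field_simp
      ring
    have h := integral_rotation m a (fun z => z ^ p * conj z ^ q)
    have h2 : ∀ z : ℂ, (a * z : ℂ) ^ p * conj (a * z : ℂ) ^ q = (-1) * (z ^ p * conj z ^ q) := by
      intro z
      rw [← key, map_mul]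
      ring
    simp_rw [h2] at h
    rw [integral_const_mul, ← hI] at h
    have : (2 : ℂ) * I = 0 := by linear_combination -h
    simpa using this

/-! ### Monomials and complex Hermite functions. -/

/-- The function `z̄ ^ a * z ^ b` as an element of `L²(μ_m)`. -/
def mono (hm : 0 < m) (a b : ℕ) : L2 m := (memLp_monomial hm a b).toLp

lemma coeFn_mono (hm : 0 < m) (a b : ℕ) :
    mono hm a b =ᵐ[gaussMeasure m] fun z => conj z ^ a * z ^ b :=
  (memLp_monomial hm a b).coeFn_toLp

lemma conjPowMul_monomial (hm : 0 < m) (s n : ℕ) (c : ℂ) :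
    conjPowMul hm s (monomial n c) = c • mono hm s n := by
  rw [mono, ← MemLp.toLp_const_smul]
  refine MemLp.toLp_congr (memLp_conj_pow_mul hm s _) _ (Filter.Eventually.of_forall fun z => ?_)
  simp only [eval_monomial, Pi.smul_apply, smul_eq_mul]
  ring

lemma inner_mono (hm : 0 < m) (a b c d : ℕ) :
    inner ℂ (mono hm a b) (mono hm c d) =
      if a + d = b + c then (((a + d)! / m ^ (a + d + 1) : ℝ) : ℂ) else 0 := by
  rw [← integral_pow_mul_conj_pow hm, L2.inner_def]
  refine integral_congr_ae ?_
  filter_upwards [coeFn_mono hm a b, coeFn_mono hm c d] with z h1 h2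
  simp only [h1, h2, RCLike.inner_apply, map_mul, map_pow, Complex.conj_conj]
  ring

lemma polyFockSpace_eq (hm : 0 < m) (N : ℕ) :
    polyFockSpace m N =
      (Submodule.span ℂ {u : L2 m | ∃ j k : ℕ, j < N ∧ u = mono hm j k}).topologicalClosure := by
  unfold polyFockSpace
  congr 3
  ext u
  refine exists_congr fun j => exists_congr fun k => and_congr_right fun _ =>
    ⟨fun h => Lp.ext (h.trans (coeFn_mono hm j k).symm), fun h => h ▸ coeFn_mono hm j k⟩

lemma mono_mem_polyFockSpace (hm : 0 < m) {N j : ℕ} (hj : j < N) (k : ℕ) :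
    mono hm j k ∈ polyFockSpace m N := by
  rw [polyFockSpace_eq hm]
  exact Submodule.le_topologicalClosure _ (Submodule.subset_span ⟨j, k, hj, rfl⟩)

lemma mem_polyFockSpace_orthogonal (hm : 0 < m) {N : ℕ} {v : L2 m}
    (h : ∀ j k : ℕ, j < N → inner ℂ (mono hm j k) v = 0) : v ∈ (polyFockSpace m N)ᗮ := by
  rw [polyFockSpace_eq hm, Submodule.orthogonal_closure, Submodule.mem_orthogonal]
  intro u hu
  induction hu using Submodule.span_induction with
  | mem u hu => obtain ⟨j, k, hj, rfl⟩ := hu; exact h j k hj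
  | zero => simp
  | add x y _ _ hx hy => rw [inner_add_left, hx, hy, add_zero]
  | smul c x _ hx => rw [inner_smul_left, hx, mul_zero]

/-- The operator `f ↦ z̄ * f - m⁻¹ * ∂f`, applied `r` times to `z̄ ^ c * z ^ k`. For `c = 0` this
is a multiple of a complex Hermite polynomial. -/
def herm (hm : 0 < m) : ℕ → ℕ → ℕ → L2 m
  | 0, c, k => mono hm c k
  | r + 1, c, k => herm hm r (c + 1) k - ((k / m : ℝ) : ℂ) • herm hm r c (k - 1)

lemma herm_mem_polyFockSpace (hm : 0 < m) {N : ℕ} (r c k : ℕ) (h : r + c < N) :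
    herm hm r c k ∈ polyFockSpace m N := by
  induction r generalizing c k with
  | zero => exact mono_mem_polyFockSpace hm (by omega) k
  | succ r ih =>
    exact Submodule.sub_mem _ (ih _ _ (by omega)) (Submodule.smul_mem _ _ (ih _ _ (by omega)))

/-- Adjointness of `z̄ - m⁻¹∂` and `m⁻¹∂̄`, iterated `r` times: `∂̄^r` takes `z̄^a` to
`a.descFactorial r` times `z̄^(a-r)`. Integration by parts is replaced by the recursion of the
factorial moments. -/
lemma inner_mono_herm (hm : 0 < m) (a b r c k : ℕ) :
    inner ℂ (mono hm a b) (herm hm r c k) =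
      ((a.descFactorial r / m ^ r : ℝ) : ℂ) * inner ℂ (mono hm (a - r) b) (mono hm c k) := by
  induction r generalizing c k with
  | zero => simp [herm]
  | succ r ih =>
    have hm' : (m : ℂ) ≠ 0 := by exact_mod_cast hm.ne'
    rw [herm, inner_sub_right, inner_smul_right, ih, ih, Nat.descFactorial_succ]
    rcases Nat.lt_or_ge r a with hra | hra
    · obtain ⟨d, rfl⟩ : ∃ d, a = r + 1 + d := ⟨a - (r + 1), by omega⟩
      have e1 : r + 1 + d - r = d + 1 := by omega
      have e2 : r + 1 + d - (r + 1) = d := by omega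
      rw [e1, e2, inner_mono, inner_mono, inner_mono]
      by_cases h : d + k = b + c
      · rw [if_pos h, if_pos (by omega)]
        rcases k with _ | k
        · simp only [CharP.cast_eq_zero, zero_div, Complex.ofReal_zero, zero_mul, sub_zero, add_zero,
            Nat.factorial_succ, pow_succ]
          push_cast
          field_simp
        · rw [if_pos (by omega)]
          have e3 : d + 1 + (k + 1) = d + k + 1 + 1 := by ring
          have e4 : d + 1 + (k + 1 - 1) = d + k + 1 := by omega
          have e5 : d + (k + 1) = d + k + 1 := by ring
          rw [e3, e4, e5, Nat.factorial_succ (d + k + 1), pow_succ m (d + k + 1 + 1), pow_succ m r]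
          push_cast
          field_simp
          ring
      · rw [if_neg h, if_neg (by omega)]
        rcases k with _ | k
        · simp
        · rw [if_neg (by omega)]; simp
    -- Here `z̄^a` has already been reduced to a constant in `z̄`, so one more derivative gives
    -- zero: the two moments cancel.
    · have e : a - r = 0 := by omega
      rw [e, inner_mono, inner_mono]
      rcases k with _ | k
      · simp
      · by_cases h : k + 1 = b + c + 1
        · rw [if_pos (by omega), if_pos (by omega)]
          simp only [zero_add, Nat.add_sub_cancel, Nat.factorial_succ, pow_succ]
          push_cast
          field_simp
          simp
        · rw [if_neg (by omega), if_neg (by omega)]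
          simp

lemma herm_mem_orthogonal (hm : 0 < m) {N r : ℕ} (h : N ≤ r) (c k : ℕ) :
    herm hm r c k ∈ (polyFockSpace m N)ᗮ := by
  refine mem_polyFockSpace_orthogonal hm fun a b ha => ?_
  rw [inner_mono_herm, Nat.descFactorial_of_lt (by omega)]
  simp

/-- Binomial theorem for `z̄^c = (D + m⁻¹∂)^c` with the commuting operators `D = z̄ - m⁻¹∂` and `∂`;
the induction step is Pascal's rule. -/
lemma herm_eq_sum (hm : 0 < m) (r c k : ℕ) :
    herm hm r c k = ∑ i ∈ Finset.range (c + 1),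
      ((c.choose i * k.descFactorial i / m ^ i : ℝ) : ℂ) • herm hm (r + (c - i)) 0 (k - i) := by
  induction c generalizing r k with
  | zero => simp
  | succ c ih =>
    have h : herm hm r (c + 1) k =
        herm hm (r + 1) c k + ((k / m : ℝ) : ℂ) • herm hm r c (k - 1) := by
      rw [herm]; abel
    rw [h, ih, ih, Finset.sum_range_succ' _ (c + 1)]
    have hsplit : ∀ i ∈ Finset.range (c + 1),
        (((c + 1).choose (i + 1) * k.descFactorial (i + 1) / m ^ (i + 1) : ℝ) : ℂ) •
          herm hm (r + (c + 1 - (i + 1))) 0 (k - (i + 1)) =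
        ((c.choose (i + 1) * k.descFactorial (i + 1) / m ^ (i + 1) : ℝ) : ℂ) •
          herm hm (r + 1 + (c - (i + 1))) 0 (k - (i + 1)) +
        ((k / m : ℝ) : ℂ) • ((c.choose i * (k - 1).descFactorial i / m ^ i : ℝ) : ℂ) •
          herm hm (r + (c - i)) 0 (k - 1 - i) := by
      intro i hi
      rw [Finset.mem_range] at hi
      have e1 : c + 1 - (i + 1) = c - i := by omega
      have e2 : k - 1 - i = k - (i + 1) := by omega
      have e3 : (k.descFactorial (i + 1) : ℝ) = k * (k - 1).descFactorial i := by
        rcases k with _ | k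
        · simp
        · rw [Nat.succ_descFactorial_succ]; push_cast; simp
      rw [e1, e2, smul_smul, Nat.choose_succ_succ, e3]
      rcases Nat.lt_or_ge i c with hic | hic
      · have e4 : r + 1 + (c - (i + 1)) = r + (c - i) := by omega
        rw [e4, ← add_smul]
        congr 1
        push_cast
        rw [pow_succ]
        have hm' : (m : ℂ) ≠ 0 := by exact_mod_cast hm.ne'
        field_simp
        ring
      -- At `i = c` the truncated index `c - (i + 1)` gives the wrong Hermite order, but its
      -- coefficient vanishes.
      · rw [Nat.choose_eq_zero_of_lt (show c < i + 1 by omega)]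
        simp only [CharP.cast_eq_zero, zero_mul, zero_div, Complex.ofReal_zero, zero_smul, zero_add,
          add_zero]
        congr 1
        push_cast
        rw [pow_succ]
        have hm' : (m : ℂ) ≠ 0 := by exact_mod_cast hm.ne'
        field_simp
    rw [Finset.sum_congr rfl hsplit, Finset.sum_add_distrib, ← Finset.smul_sum, add_right_comm]
    congr 1
    rw [Finset.sum_range_succ' _ c, Finset.sum_range_succ _ c,
      Nat.choose_eq_zero_of_lt (Nat.lt_succ_self c)]
    simp [add_assoc, add_comm 1 c]

end FockHankel

end

/-! ### Inner products and norms of the images of monomials. -/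

noncomputable section

namespace FockHankel

variable {m : ℝ}

lemma inner_self_eq_ofReal {E : Type*} [NormedAddCommGroup E] [InnerProductSpace ℂ E] (x : E) :
    inner ℂ x x = ((‖x‖ ^ 2 : ℝ) : ℂ) := by
  rw [inner_self_eq_norm_sq_to_K, Complex.ofReal_pow]
  rfl

lemma hankel_apply (hm : 0 < m) (N s : ℕ) (p : ℂ[X]) :
    hankel hm N s p =
      conjPowMul hm s p - (polyFockSpace m N).starProjection (conjPowMul hm s p) := rfl

lemma hankel_monomial (hm : 0 < m) (N s n : ℕ) (c : ℂ) :
    hankel hm N s (monomial n c) = c • hankel hm N s (monomial n 1) := by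
  rw [← map_smul, smul_monomial, smul_eq_mul, mul_one]

lemma hankel_monomial_one (hm : 0 < m) (N s n : ℕ) :
    hankel hm N s (monomial n 1) =
      mono hm s n - (polyFockSpace m N).starProjection (mono hm s n) := by
  rw [hankel_apply, conjPowMul_monomial, one_smul]

lemma hankel_monomial_one_eq_sum (hm : 0 < m) (N s n : ℕ) :
    hankel hm N s (monomial n 1) = ∑ i ∈ Finset.range (s + 1), if N ≤ s - i then
      ((s.choose i * n.descFactorial i / m ^ i : ℝ) : ℂ) • herm hm (s - i) 0 (n - i) else 0 := by
  set g : ℕ → L2 m := fun i =>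
    ((s.choose i * n.descFactorial i / m ^ i : ℝ) : ℂ) • herm hm (s - i) 0 (n - i) with hg
  have h : mono hm s n = (∑ i ∈ Finset.range (s + 1), if N ≤ s - i then 0 else g i) +
      ∑ i ∈ Finset.range (s + 1), if N ≤ s - i then g i else 0 := by
    rw [← Finset.sum_add_distrib]
    refine (herm_eq_sum hm 0 s n).trans (Finset.sum_congr rfl fun i _ => ?_)
    split_ifs <;> simp [hg]
  rw [hankel_monomial_one, Submodule.eq_starProjection_of_mem_orthogonal' ?_ ?_ h]
  · rw [h, add_sub_cancel_left]
  · refine Submodule.sum_mem _ fun i _ => ?_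
    split_ifs
    · exact Submodule.zero_mem _
    · exact Submodule.smul_mem _ _ (herm_mem_polyFockSpace hm _ _ _ (by omega))
  · refine Submodule.sum_mem _ fun i _ => ?_
    split_ifs with hi
    · exact Submodule.smul_mem _ _ (herm_mem_orthogonal hm hi _ _)
    · exact Submodule.zero_mem _

/-- `I - P` is a self-adjoint idempotent, so only one argument has to be expanded in Hermite
functions. -/
lemma inner_hankel_eq_inner_conjPowMul (hm : 0 < m) (N s : ℕ) (p q : ℂ[X]) :
    inner ℂ (hankel hm N s p) (hankel hm N s q) =
      inner ℂ (conjPowMul hm s p) (hankel hm N s q) := by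
  conv_lhs => rw [hankel_apply hm N s p, inner_sub_left]
  rw [Submodule.inner_right_of_mem_orthogonal (Submodule.starProjection_apply_mem _ _)
    (hankel_apply hm N s q ▸ Submodule.sub_starProjection_mem_orthogonal _), sub_zero]

/-- The square of the norm of the image of the `n`-th basis vector. -/
def hankelNormSq (m : ℝ) (N s n : ℕ) : ℝ :=
  (s ! : ℝ) / m ^ s * ∑ r ∈ Finset.Icc N s, (n.choose (s - r) : ℝ) * (s.choose r : ℝ)

lemma inner_hankel_monomial (hm : 0 < m) (N s n p : ℕ) :
    inner ℂ (hankel hm N s (monomial n 1)) (hankel hm N s (monomial p 1)) =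
      if n = p then ((n ! / m ^ (n + 1) * hankelNormSq m N s n : ℝ) : ℂ) else 0 := by
  have hterm : ∀ i ∈ Finset.range (s + 1), inner ℂ (mono hm s n) (if N ≤ s - i then
      ((s.choose i * p.descFactorial i / m ^ i : ℝ) : ℂ) • herm hm (s - i) 0 (p - i) else 0) =
      if n = p then ((n ! / m ^ (n + 1) * (s ! / m ^ s * if N ≤ s - i then
        (n.choose i : ℝ) * s.choose i else 0) : ℝ) : ℂ) else 0 := by
    intro i hi
    have his : i ≤ s := by rw [Finset.mem_range] at hi; omega
    by_cases hN : N ≤ s - i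
    · have e1 : s - (s - i) = i := by omega
      rw [if_pos hN, if_pos hN, inner_smul_right, inner_mono_herm, e1, inner_mono]
      -- For `p < i` the exponent `p - i` is truncated, but then `p.descFactorial i = 0`.
      rcases Nat.lt_or_ge p i with hp | hp
      · rw [Nat.descFactorial_of_lt hp]
        by_cases hnp : n = p
        · subst hnp
          simp [Nat.choose_eq_zero_of_lt hp]
        · simp [hnp]
      · have e2 : i + (p - i) = p := by omega
        rw [e2, add_zero]
        by_cases hnp : n = p
        · subst hnp
          rw [if_pos rfl, if_pos rfl, ← Complex.ofReal_mul, ← Complex.ofReal_mul]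
          congr 1
          have h1 := Nat.factorial_mul_descFactorial (Nat.sub_le s i)
          rw [e1] at h1
          have h2 := Nat.descFactorial_eq_factorial_mul_choose n i
          have h3 : m ^ s = m ^ i * m ^ (s - i) := by rw [← pow_add]; congr 1; omega
          rw [h2, h3, ← h1]
          push_cast
          field_simp
        · rw [if_neg (Ne.symm hnp), if_neg hnp]; simp
    · simp [hN]
  rw [inner_hankel_eq_inner_conjPowMul, conjPowMul_monomial, one_smul, hankel_monomial_one_eq_sum,
    inner_sum, Finset.sum_congr rfl hterm]
  split_ifs with h
  · rw [← Complex.ofReal_sum, ← Finset.mul_sum, ← Finset.mul_sum, hankelNormSq]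
    congr 3
    -- Reindexing by `r = s - i` turns the condition `N ≤ s - i` into `N ≤ r`.
    rw [← Finset.sum_range_reflect, ← Finset.sum_filter_add_sum_filter_not _ (fun i => N ≤ i)]
    have h0 : ∑ i ∈ Finset.range (s + 1) with ¬ N ≤ i, (if N ≤ s - (s + 1 - 1 - i) then
        (n.choose (s + 1 - 1 - i) : ℝ) * s.choose (s + 1 - 1 - i) else 0) = 0 := by
      refine Finset.sum_eq_zero fun i hi => ?_
      simp only [Finset.mem_filter, Finset.mem_range] at hi
      rw [if_neg (by omega)]
    rw [h0, add_zero]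
    have hset : Finset.filter (fun i => N ≤ i) (Finset.range (s + 1)) = Finset.Icc N s := by
      ext i
      simp only [Finset.mem_filter, Finset.mem_range, Finset.mem_Icc]
      omega
    rw [hset]
    refine Finset.sum_congr rfl fun i hi => ?_
    rw [Finset.mem_Icc] at hi
    rw [if_pos (by omega), Nat.add_sub_cancel, Nat.choose_symm hi.2]
  · exact Finset.sum_const_zero

lemma inner_hankel_basisPoly (hm : 0 < m) (N s n p : ℕ) :
    inner ℂ (hankel hm N s (basisPoly m n)) (hankel hm N s (basisPoly m p)) =
      if n = p then (hankelNormSq m N s n : ℂ) else 0 := by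
  rw [basisPoly, basisPoly, hankel_monomial, hankel_monomial hm N s p, inner_smul_left,
    inner_smul_right, inner_hankel_monomial]
  split_ifs with h
  · subst h
    rw [Complex.conj_ofReal, ← Complex.ofReal_mul, ← Complex.ofReal_mul, ← mul_assoc,
      Real.mul_self_sqrt (by positivity)]
    congr 1
    field_simp
  · simp

lemma norm_hankel_basisPoly_sq (hm : 0 < m) (N s n : ℕ) :
    ‖hankel hm N s (basisPoly m n)‖ ^ 2 = hankelNormSq m N s n := by
  have h := inner_hankel_basisPoly hm N s n n
  rw [if_pos rfl, inner_self_eq_ofReal] at h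
  exact_mod_cast h

lemma coe_polyToFock (hm : 0 < m) (p : ℂ[X]) :
    (polyToFock hm p : L2 m) = conjPowMul hm 0 p := rfl

lemma inner_conjPowMul_zero_monomial (hm : 0 < m) (n p : ℕ) :
    inner ℂ (mono hm 0 n) (mono hm 0 p) =
      if n = p then ((n ! / m ^ (n + 1) : ℝ) : ℂ) else 0 := by
  rw [inner_mono, zero_add, add_zero]
  by_cases h : n = p
  · subst h; rfl
  · rw [if_neg h, if_neg (Ne.symm h)]

lemma norm_polyToFock_basisPoly (hm : 0 < m) (n : ℕ) : ‖polyToFock hm (basisPoly m n)‖ = 1 := by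
  have h : ‖polyToFock hm (basisPoly m n)‖ ^ 2 = 1 := by
    have h1 : inner ℂ (conjPowMul hm 0 (basisPoly m n)) (conjPowMul hm 0 (basisPoly m n)) = 1 := by
      rw [basisPoly, conjPowMul_monomial, inner_smul_left, inner_smul_right,
        inner_conjPowMul_zero_monomial, if_pos rfl, Complex.conj_ofReal, ← Complex.ofReal_mul,
        ← Complex.ofReal_mul, ← mul_assoc, Real.mul_self_sqrt (by positivity)]
      norm_cast
      field_simp
    rw [inner_self_eq_ofReal] at h1
    rw [← coe_polyToFock] at h1
    exact_mod_cast h1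
  exact (pow_eq_one_iff_of_nonneg (norm_nonneg _) two_ne_zero).1 h

lemma hankelNormSq_self (m : ℝ) (N n : ℕ) : hankelNormSq m N N n = N ! / m ^ N := by
  simp [hankelNormSq]

lemma hankelNormSq_pos (hm : 0 < m) {N s : ℕ} (h : N ≤ s) : 0 < hankelNormSq m N s s := by
  refine mul_pos (by positivity) (Finset.sum_pos (fun r hr => ?_) ⟨N, by simp [h]⟩)
  have h1 := Nat.choose_pos (Nat.sub_le s r)
  have h2 := Nat.choose_pos (Finset.mem_Icc.1 hr).2
  positivity

/-- The single term `r = s - 1` contributes `n * s`; it is present because `N < s`. -/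
lemma le_hankelNormSq (hm : 0 < m) {N s : ℕ} (h : N < s) (n : ℕ) :
    s ! / m ^ s * n ≤ hankelNormSq m N s n := by
  refine mul_le_mul_of_nonneg_left ?_ (by positivity)
  have hs : s - 1 ∈ Finset.Icc N s := Finset.mem_Icc.2 (by omega)
  refine le_trans ?_ (Finset.single_le_sum (fun r _ => by positivity) hs)
  have e1 : s - (s - 1) = 1 := by omega
  have e2 : 0 < s.choose (s - 1) := Nat.choose_pos (by omega)
  rw [e1, Nat.choose_one_right]
  exact le_mul_of_one_le_right (by positivity) (by exact_mod_cast e2)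

/-! ### Vanishing, boundedness and compactness. -/

lemma hankel_eq_zero_iff (hm : 0 < m) (N s : ℕ) : hankel hm N s = 0 ↔ s < N := by
  constructor
  · intro h
    by_contra hs
    -- With `n = s` all the binomial coefficients in the sum are positive.
    have h1 := norm_hankel_basisPoly_sq hm N s s
    rw [h] at h1
    have h2 := hankelNormSq_pos hm (not_lt.1 hs)
    simp at h1
    linarith
  · intro h
    refine Polynomial.lhom_ext' fun n => LinearMap.ext_ring ?_
    change hankel hm N s (monomial n 1) = 0
    rw [hankel_monomial_one,
      Submodule.starProjection_eq_self_iff.2 (mono_mem_polyFockSpace hm h n), sub_self]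

lemma le_of_extends {hm : 0 < m} {N s : ℕ} {T : fockSpace m →L[ℂ] L2 m}
    (hT : Extends hm N s T) : s ≤ N := by
  by_contra! h
  have hb : ∀ n : ℕ, hankelNormSq m N s n ≤ ‖T‖ ^ 2 := by
    intro n
    have h1 := T.le_opNorm (polyToFock hm (basisPoly m n))
    rw [hT, norm_polyToFock_basisPoly, mul_one] at h1
    rw [← norm_hankel_basisPoly_sq hm]
    gcongr
  have hc : 0 < (s ! : ℝ) / m ^ s := by positivity
  obtain ⟨n, hn⟩ := exists_nat_gt (‖T‖ ^ 2 / (s ! / m ^ s))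
  rw [div_lt_iff₀ hc] at hn
  linarith [hb n, le_hankelNormSq hm h n]

lemma inner_hankel_self (hm : 0 < m) (N : ℕ) (p q : ℂ[X]) :
    inner ℂ (hankel hm N N p) (hankel hm N N q) =
      ((N ! / m ^ N : ℝ) : ℂ) * inner ℂ (conjPowMul hm 0 p) (conjPowMul hm 0 q) := by
  induction p using Polynomial.induction_on' with
  | add p₁ p₂ h1 h2 => rw [map_add, map_add, inner_add_left, inner_add_left, h1, h2, mul_add]
  | monomial n a =>
    induction q using Polynomial.induction_on' with
    | add p₁ p₂ h1 h2 => rw [map_add, map_add, inner_add_right, inner_add_right, h1, h2, mul_add]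
    | monomial k b =>
      rw [hankel_monomial, hankel_monomial hm N N k, conjPowMul_monomial, conjPowMul_monomial]
      simp only [inner_smul_left, inner_smul_right]
      rw [inner_hankel_monomial, inner_conjPowMul_zero_monomial, hankelNormSq_self]
      split_ifs
      · push_cast; ring
      · simp

lemma norm_hankel_self (hm : 0 < m) (N : ℕ) (p : ℂ[X]) :
    ‖hankel hm N N p‖ = √(N ! / m ^ N) * ‖conjPowMul hm 0 p‖ := by
  have h := inner_hankel_self hm N p p
  rw [inner_self_eq_ofReal, inner_self_eq_ofReal] at h
  have h' : ‖hankel hm N N p‖ ^ 2 = N ! / m ^ N * ‖conjPowMul hm 0 p‖ ^ 2 := by exact_mod_cast h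
  rw [← Real.sqrt_sq (norm_nonneg (hankel hm N N p)), h', Real.sqrt_mul (by positivity),
    Real.sqrt_sq (norm_nonneg _)]

/-- The closure in `L²(μ_m)` of the space of analytic polynomials. -/
abbrev polyClosure (hm : 0 < m) : Submodule ℂ (L2 m) :=
  (LinearMap.range (conjPowMul hm 0)).topologicalClosure

lemma conjPowMul_zero_mem_polyClosure (hm : 0 < m) (p : ℂ[X]) :
    conjPowMul hm 0 p ∈ polyClosure hm :=
  Submodule.le_topologicalClosure _ (LinearMap.mem_range_self _ p)

instance (hm : 0 < m) : CompleteSpace (polyClosure hm) :=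
  Submodule.topologicalClosure.completeSpace _

/-- The inclusion of the analytic polynomials in their closure. -/
def polyToClosure (hm : 0 < m) : ℂ[X] →ₗ[ℂ] polyClosure hm :=
  (conjPowMul hm 0).codRestrict _ (conjPowMul_zero_mem_polyClosure hm)

lemma denseRange_polyToClosure (hm : 0 < m) : DenseRange (polyToClosure hm) := by
  intro x
  rw [closure_subtype]
  have h : (Subtype.val '' Set.range (polyToClosure hm) : Set (L2 m)) =
      (LinearMap.range (conjPowMul hm 0) : Set (L2 m)) := by
    ext y
    simp [polyToClosure]
  rw [h]
  exact x.2

/-- The multiple of an isometry extends by continuity to the closure of the polynomials.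
Precomposing with the orthogonal projection onto that closure makes it defined on the Fock space
without using density. -/
lemma exists_extends_self (hm : 0 < m) (N : ℕ) :
    ∃ T : fockSpace m →L[ℂ] L2 m, Extends hm N N T := by
  refine ⟨((hankel hm N N).extendOfNorm (polyToClosure hm)) ∘L
    (polyClosure hm).orthogonalProjectionOnto ∘L (fockSpace m).subtypeL, fun p => ?_⟩
  have h1 : (polyClosure hm).orthogonalProjectionOnto ((fockSpace m).subtypeL (polyToFock hm p)) =
      polyToClosure hm p :=
    Submodule.orthogonalProjectionOnto_mem_subspace_eq_self (polyToClosure hm p)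
  rw [ContinuousLinearMap.comp_apply, ContinuousLinearMap.comp_apply, h1]
  exact LinearMap.extendOfNorm_eq (denseRange_polyToClosure hm)
    ⟨_, fun q => (norm_hankel_self hm N q).le⟩ p

lemma exists_extends_iff (hm : 0 < m) (N s : ℕ) :
    (∃ T : fockSpace m →L[ℂ] L2 m, Extends hm N s T) ↔ s ≤ N := by
  refine ⟨fun ⟨_, hT⟩ => le_of_extends hT, fun h => ?_⟩
  rcases h.lt_or_eq with h | rfl
  · exact ⟨0, fun p => by rw [(hankel_eq_zero_iff hm N s).2 h]; rfl⟩
  · exact exists_extends_self hm s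

lemma lt_of_isCompactOperator {hm : 0 < m} {N s : ℕ} {T : fockSpace m →L[ℂ] L2 m}
    (hT : Extends hm N s T) (hc : IsCompactOperator T) : s < N := by
  refine lt_of_le_of_ne (le_of_extends hT) ?_
  rintro rfl
  obtain ⟨K, hK, hKT⟩ := hc.image_closedBall_subset_compact (1 : ℝ)
  set v : ℕ → L2 m := fun n => hankel hm s s (basisPoly m n) with hv
  have hvK : ∀ n, v n ∈ K := fun n => hKT ⟨polyToFock hm (basisPoly m n), by
    simpa using (norm_polyToFock_basisPoly hm n).le, hT _⟩
  obtain ⟨a, -, ψ, hψ, hlim⟩ := hK.tendsto_subseq hvK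
  have hcau := hlim.cauchySeq
  have hpos : 0 < (s ! : ℝ) / m ^ s := by positivity
  obtain ⟨n, hn⟩ := Metric.cauchySeq_iff.1 hcau (√(s ! / m ^ s)) (Real.sqrt_pos.2 hpos)
  have hlt := hn n le_rfl (n + 1) (Nat.le_succ n)
  have hne : ψ n ≠ ψ (n + 1) := (hψ (Nat.lt_succ_self n)).ne
  -- Orthogonal vectors of equal norm stay a fixed distance apart, so no subsequence is Cauchy.
  have hsq : ‖v (ψ n) - v (ψ (n + 1))‖ ^ 2 = 2 * (s ! / m ^ s) := by
    have h := norm_sub_sq (𝕜 := ℂ) (v (ψ n)) (v (ψ (n + 1)))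
    rw [h, hv]
    simp only
    rw [inner_hankel_basisPoly, if_neg hne, norm_hankel_basisPoly_sq, norm_hankel_basisPoly_sq,
      hankelNormSq_self, hankelNormSq_self]
    simp
    ring
  rw [dist_eq_norm] at hlt
  have := Real.lt_sqrt (norm_nonneg _) |>.1 hlt
  simp only [Function.comp_apply] at this
  linarith

end FockHankel

end

/-! ### Density of the analytic polynomials in the Fock space. -/

noncomputable section

namespace FockHankel

variable {m : ℝ}

instance (m : ℝ) : SFinite (gaussMeasure m) := by
  unfold gaussMeasure
  infer_instance

/-- Cauchy's formula for the Taylor coefficients of `w ↦ f (z * w)`, over the unit circle. -/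
lemma intervalIntegral_comp_mul_exp {f : ℂ → ℂ} (hf : Differentiable ℂ f) (n : ℕ) (z : ℂ) :
    ∫ θ in (0 : ℝ)..2 * Real.pi,
      Complex.exp (-(n * (θ * Complex.I))) * f (Complex.exp (θ * Complex.I) * z) =
      2 * Real.pi * ((n ! : ℂ)⁻¹ * iteratedDeriv n f 0 * z ^ n) := by
  have hg : Differentiable ℂ fun w => f (z * w) := hf.comp (differentiable_id.const_mul z)
  have h := hg.differentiableOn.circleIntegral_one_div_sub_center_pow_smul (c := 0) zero_lt_one n
  rw [congrFun (iteratedDeriv_comp_const_mul (n := n) hf.contDiff z) 0, circleIntegral] at h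
  have hint : ∀ θ : ℝ, deriv (circleMap 0 1) θ • ((1 / (circleMap 0 1 θ - 0) ^ (n + 1)) •
      f (z * circleMap 0 1 θ)) =
      Complex.I * (Complex.exp (-(n * (θ * Complex.I))) * f (Complex.exp (θ * Complex.I) * z)) := by
    intro θ
    have hne := Complex.exp_ne_zero (θ * Complex.I)
    rw [deriv_circleMap]
    simp only [circleMap, Complex.ofReal_one, one_mul, zero_add, sub_zero, smul_eq_mul]
    rw [Complex.exp_neg, Complex.exp_nat_mul, mul_comm z]
    field_simp
    ring
  simp_rw [hint] at h
  rw [intervalIntegral.integral_const_mul] at h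
  refine mul_left_cancel₀ Complex.I_ne_zero (h.trans ?_)
  simp only [mul_zero, smul_eq_mul]
  field_simp

/-- Pairing an entire function in `L²(μ_m)` with `z ^ n` returns its `n`-th Taylor coefficient,
up to the moment of order `n`. -/
lemma integral_mul_conj_pow (hm : 0 < m) {f : ℂ → ℂ} (hf : Differentiable ℂ f)
    (hf2 : MemLp f 2 (gaussMeasure m)) (n : ℕ) :
    ∫ z, f z * conj z ^ n ∂gaussMeasure m =
      (n ! : ℂ)⁻¹ * iteratedDeriv n f 0 * ((n ! / m ^ (n + 1) : ℝ) : ℂ) := by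
  set μ := gaussMeasure m with hμ
  set ν : Measure ℝ := volume.restrict (Set.Ioc 0 (2 * Real.pi)) with hν
  have hmono : MemLp (fun z : ℂ => conj z ^ n) 2 μ := by simpa using memLp_monomial hm n 0
  have hG : Integrable (fun z => f z * conj z ^ n) μ := hf2.integrable_mul hmono
  have hrot : ∀ θ : ℝ, ∀ g : ℂ → ℂ,
      ∫ z, g (Complex.exp (θ * Complex.I) * z) ∂μ = ∫ z, g z ∂μ := by
    intro θ g
    have := integral_rotation m (Circle.exp θ) g
    rwa [Circle.coe_exp] at this
  have hint : Integrable (Function.uncurry fun (z : ℂ) (θ : ℝ) =>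
      f (Complex.exp (θ * Complex.I) * z) * conj (Complex.exp (θ * Complex.I) * z) ^ n)
      (μ.prod ν) := by
    have hcont : Continuous (Function.uncurry fun (z : ℂ) (θ : ℝ) =>
        f (Complex.exp (θ * Complex.I) * z) * conj (Complex.exp (θ * Complex.I) * z) ^ n) := by
      have := hf.continuous
      fun_prop
    rw [integrable_prod_iff' hcont.aestronglyMeasurable]
    constructor
    · refine Filter.Eventually.of_forall fun θ => ?_
      have h := (measurePreserving_rotation m (Circle.exp θ)).integrable_comp_of_integrable hG
      simpa [Function.comp_def, Function.uncurry, Circle.coe_exp] using h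
    -- By rotation invariance the `L¹` norm of the slices is constant in `θ`, hence integrable over
    -- a finite interval.
    · have hc : ∀ θ : ℝ, ∫ z, ‖f (Complex.exp (θ * Complex.I) * z) *
          conj (Complex.exp (θ * Complex.I) * z) ^ n‖ ∂μ = ∫ z, ‖f z * conj z ^ n‖ ∂μ := by
        intro θ
        have h := (measurePreserving_rotation m (Circle.exp θ)).integral_comp
          (rotation (Circle.exp θ)).toHomeomorph.measurableEmbedding (fun z => ‖f z * conj z ^ n‖)
        simpa [Circle.coe_exp] using h
      simp only [Function.uncurry_apply_pair]
      simp_rw [hc]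
      exact integrable_const _
  -- Averaging over rotations: integrating in `θ` first isolates the `n`-th Taylor term by Cauchy's
  -- formula; integrating in `z` first gives `2π` times the original integral.
  have hswap := integral_integral_swap hint
  have hleft : ∀ z : ℂ, ∫ θ, f (Complex.exp (θ * Complex.I) * z) *
      conj (Complex.exp (θ * Complex.I) * z) ^ n ∂ν =
      2 * Real.pi * ((n ! : ℂ)⁻¹ * iteratedDeriv n f 0) * (z ^ n * conj z ^ n) := by
    intro z
    have h := intervalIntegral_comp_mul_exp hf n z
    rw [intervalIntegral.integral_of_le (by positivity)] at h
    have hz : ∀ θ : ℝ, f (Complex.exp (θ * Complex.I) * z) *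
        conj (Complex.exp (θ * Complex.I) * z) ^ n = (Complex.exp (-(n * (θ * Complex.I))) *
          f (Complex.exp (θ * Complex.I) * z)) * conj z ^ n := by
      intro θ
      have : conj (Complex.exp (θ * Complex.I)) ^ n = Complex.exp (-(n * (θ * Complex.I))) := by
        rw [← Complex.exp_conj, ← Complex.exp_nat_mul]
        simp
      rw [map_mul, mul_pow, this]
      ring
    simp_rw [hz]
    rw [integral_mul_const, h]
    ring
  simp_rw [hleft] at hswap
  rw [integral_const_mul, integral_pow_mul_conj_pow hm, if_pos rfl] at hswap
  have hright : ∀ θ : ℝ, ∫ z, f (Complex.exp (θ * Complex.I) * z) *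
      conj (Complex.exp (θ * Complex.I) * z) ^ n ∂μ = ∫ z, f z * conj z ^ n ∂μ :=
    fun θ => hrot θ fun z => f z * conj z ^ n
  simp_rw [hright] at hswap
  have hvol : ν.real Set.univ = 2 * Real.pi := by
    simp [hν, Real.pi_nonneg]
  rw [integral_const, hvol, Complex.real_smul] at hswap
  have hpi : ((2 * Real.pi : ℝ) : ℂ) ≠ 0 := by
    have := Real.pi_pos
    exact_mod_cast (by positivity : (2 * Real.pi : ℝ) ≠ 0)
  refine mul_left_cancel₀ hpi (hswap.symm.trans ?_)
  push_cast
  ring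

/-- Analytic polynomials are dense in the Fock space. -/
lemma fockSpace_le_polyClosure (hm : 0 < m) : fockSpace m ≤ polyClosure hm := by
  rintro u ⟨f, hf, huf⟩
  have hf2 : MemLp f 2 (gaussMeasure m) := (memLp_congr_ae huf).1 (Lp.memLp u)
  set e : ℕ → L2 m := fun n => conjPowMul hm 0 (basisPoly m n) with he
  have hcoef : ∀ n, (0 : ℝ) < m ^ (n + 1) / n ! := fun n => by positivity
  have he' : ∀ n, e n = ((√(m ^ (n + 1) / n !) : ℝ) : ℂ) • mono hm 0 n := fun n => by
    simp only [he]
    rw [basisPoly, conjPowMul_monomial]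
  have horth : Orthonormal ℂ e := by
    rw [orthonormal_iff_ite]
    intro i j
    rw [he', he', inner_smul_left, inner_smul_right, inner_conjPowMul_zero_monomial]
    split_ifs with hij
    · subst hij
      rw [Complex.conj_ofReal, ← Complex.ofReal_mul, ← Complex.ofReal_mul, ← mul_assoc,
        Real.mul_self_sqrt (hcoef i).le]
      norm_cast
      field_simp
    · simp
  have hterm : ∀ n, inner ℂ (e n) u • e n =
      ((n ! : ℂ)⁻¹ * iteratedDeriv n f 0) • mono hm 0 n := by
    intro n
    have h1 : inner ℂ (mono hm 0 n) u = ∫ z, f z * conj z ^ n ∂gaussMeasure m := by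
      rw [L2.inner_def]
      refine integral_congr_ae ?_
      filter_upwards [coeFn_mono hm 0 n, huf] with z hz1 hz2
      simp [hz1, hz2]
    have h2 : ((√(m ^ (n + 1) / n !) : ℝ) : ℂ) * ((√(m ^ (n + 1) / n !) : ℝ) : ℂ) =
        ((m ^ (n + 1) / n ! : ℝ) : ℂ) := by
      rw [← Complex.ofReal_mul, Real.mul_self_sqrt (hcoef n).le]
    have h3 : ((n ! / m ^ (n + 1) : ℝ) : ℂ) * ((m ^ (n + 1) / n ! : ℝ) : ℂ) = 1 := by
      norm_cast
      field_simp
    rw [he', inner_smul_left, Complex.conj_ofReal, h1, integral_mul_conj_pow hm hf hf2, smul_smul]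
    congr 1
    linear_combination (n ! : ℂ)⁻¹ * iteratedDeriv n f 0 * ((n ! / m ^ (n + 1) : ℝ) : ℂ) * h2 +
      (n ! : ℂ)⁻¹ * iteratedDeriv n f 0 * h3
  -- Bessel's inequality makes the Fourier series converge in `L²`; that its sum is `u` is still to
  -- be shown.
  have hsum : Summable fun n => inner ℂ (e n) u • e n := by
    have := horth.orthogonalFamily.summable_iff_norm_sq_summable
      (f := fun n => (inner ℂ (e n) u : ℂ))
    simp only [LinearIsometry.toSpanSingleton_apply] at this
    exact this.2 (Orthonormal.inner_products_summable u horth)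
  obtain ⟨v, hv⟩ := hsum
  have hvK : v ∈ polyClosure hm := by
    refine (Submodule.isClosed_topologicalClosure _).mem_of_tendsto hv
      (Filter.Eventually.of_forall fun S => ?_)
    exact Submodule.sum_mem _ fun n _ =>
      Submodule.smul_mem _ _ (conjPowMul_zero_mem_polyClosure hm _)
  -- The partial sums are Taylor polynomials of `f`. A subsequence tends to `v` almost everywhere,
  -- while the Taylor series tends to `f` everywhere.
  have huv : u = v := by
    obtain ⟨ψ, hψ, hlim⟩ := (tendstoInMeasure_of_tendsto_Lp hv.tendsto_sum_nat).exists_seq_tendsto_ae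
    have hpart : ∀ k : ℕ, ∀ᵐ z ∂gaussMeasure m,
        (∑ n ∈ Finset.range k, inner ℂ (e n) u • e n : L2 m) z =
          ∑ n ∈ Finset.range k, (n ! : ℂ)⁻¹ • (z - 0) ^ n • iteratedDeriv n f 0 := by
      intro k
      induction k with
      | zero =>
        simp only [Finset.range_zero, Finset.sum_empty]
        exact Lp.coeFn_zero ℂ 2 (gaussMeasure m)
      | succ k ih =>
        rw [Finset.sum_range_succ, hterm k]
        filter_upwards [ih, Lp.coeFn_add (∑ n ∈ Finset.range k, inner ℂ (e n) u • e n)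
          (((k ! : ℂ)⁻¹ * iteratedDeriv k f 0) • mono hm 0 k), coeFn_mono hm 0 k,
          Lp.coeFn_smul ((k ! : ℂ)⁻¹ * iteratedDeriv k f 0) (mono hm 0 k)] with z h1 h2 h3 h4
        rw [h2, Pi.add_apply, h1, h4, Pi.smul_apply, h3, Finset.sum_range_succ]
        simp only [pow_zero, one_mul, smul_eq_mul, sub_zero]
        ring
    refine Lp.ext ?_
    filter_upwards [hlim, ae_all_iff.2 hpart, huf] with z h1 h2 h3
    have h4 := ((Complex.hasSum_taylorSeries_of_entire hf 0 z).tendsto_sum_nat).comp hψ.tendsto_atTop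
    simp only [h2] at h1
    rw [h3]
    exact tendsto_nhds_unique h4 h1
  exact huv ▸ hvK

lemma eq_zero_of_extends_of_lt {hm : 0 < m} {N s : ℕ} (hs : s < N)
    {T : fockSpace m →L[ℂ] L2 m} (hT : Extends hm N s T) : T = 0 := by
  have hd : DenseRange (polyToFock hm) := by
    intro x
    rw [closure_subtype]
    have h : (Subtype.val '' Set.range (polyToFock hm) : Set (L2 m)) =
        (LinearMap.range (conjPowMul hm 0) : Set (L2 m)) := by
      ext y
      simp [← coe_polyToFock]
    rw [h]
    exact fockSpace_le_polyClosure hm x.2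
  refine DFunLike.coe_injective (hd.equalizer T.continuous continuous_const ?_)
  funext p
  simp [hT p, (hankel_eq_zero_iff hm N s).2 hs]

end FockHankel

end

theorem theorem2 {m : ℝ} (hm : 0 < m) (N s : ℕ) :
    -- bounded extension to the Fock space
    ((∃ T : FockHankel.fockSpace m →L[ℂ] FockHankel.L2 m, FockHankel.Extends hm N s T) ↔ s ≤ N) ∧
    -- it has a compact extension iff it is the zero operator, iff `s < N`
    ((∃ T : FockHankel.fockSpace m →L[ℂ] FockHankel.L2 m,
        FockHankel.Extends hm N s T ∧ IsCompactOperator T) ↔ FockHankel.hankel hm N s = 0) ∧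
    (FockHankel.hankel hm N s = 0 ↔ s < N) ∧
    -- the same for any bounded extension
    (∀ T : FockHankel.fockSpace m →L[ℂ] FockHankel.L2 m, FockHankel.Extends hm N s T →
        (IsCompactOperator T ↔ T = 0)) ∧
    -- the images of the basis vectors are mutually orthogonal
    (∀ p n : ℕ, p ≠ n →
      inner ℂ (FockHankel.hankel hm N s (FockHankel.basisPoly m p))
        (FockHankel.hankel hm N s (FockHankel.basisPoly m n)) = 0) ∧
    -- and have the stated norms
    (∀ n : ℕ, ‖FockHankel.hankel hm N s (FockHankel.basisPoly m n)‖ ^ 2 =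
      (s ! : ℝ) / m ^ s * ∑ r ∈ Finset.Icc N s, (n.choose (s - r) : ℝ) * (s.choose r : ℝ)) := by
  have hcompact : ∀ T : FockHankel.fockSpace m →L[ℂ] FockHankel.L2 m,
      FockHankel.Extends hm N s T → (IsCompactOperator T ↔ T = 0) := fun T hT =>
    ⟨fun hc => FockHankel.eq_zero_of_extends_of_lt (FockHankel.lt_of_isCompactOperator hT hc) hT,
      fun h => h ▸ isCompactOperator_zero⟩
  refine ⟨FockHankel.exists_extends_iff hm N s, ⟨fun ⟨T, hT, hc⟩ => ?_, fun h => ?_⟩,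
    FockHankel.hankel_eq_zero_iff hm N s, hcompact, fun p n hpn => ?_,
    FockHankel.norm_hankel_basisPoly_sq hm N s⟩
  · exact (FockHankel.hankel_eq_zero_iff hm N s).2 (FockHankel.lt_of_isCompactOperator hT hc)
  · exact ⟨0, fun p => by rw [h]; rfl, isCompactOperator_zero⟩
  · rw [FockHankel.inner_hankel_basisPoly, if_neg hpn]
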